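/- Consider a bipartite system $\mathbb{C}^{d_A}\otimes\mathbb{C}^{d_B}$. A finite LOCC protocol with output in $[n]=\{1,\dots,n\}$ is a finite-depth procedure in which at each step either Alice or Bob applies to her or his system a local quantum instrument with finitely many outcomes (a finite family of completely positive maps, possibly to spaces of other dimensions, that sum to a trace-preserving map) and communicates the outcome, the subsequent steps depending on the outcomes communicated so far; at the end a label in $[n]$, determined by these outcomes, is output. It implements the measurement (POVM) $\{M_i\}_{i\in[n]}$ for which label $i$ is output on input state $\rho$ with probability $\operatorname{tr}(M_i\rho)$. A measurement is in finite LOCC, $\mathrm{LOCC}_{\mathbb{N}}$, if some finite LOCC protocol implements it, and in asymptotic LOCC, $\overline{\mathrm{LOCC}}$, if it is a limit of a sequence of measurements in $\mathrm{LOCC}_{\mathbb{N}}$ (with the same $d_A$, $d_B$, $n$). (1) Let $\mathcal{M}=\{P_i^A\otimes P_i^B\}_{i\in[n]}$ be a projective measurement on $\mathbb{C}^{d_A}\otimes\mathbb{C}^{d_B}$ (mutually orthogonal projectors that sum to the identity), where $P_i^A$ and $P_i^B$ are orthogonal projectors on $\mathbb{C}^{d_A}$ and $\mathbb{C}^{d_B}$.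 If $\mathcal{M}\in\overline{\mathrm{LOCC}}$, then $\mathcal{M}\in\mathrm{LOCC}_{\mathbb{N}}$. (2) Let $\rho_i=\tau_i\otimes\sigma_i$, $i\in[n]$, be product states (with $\tau_i$, $\sigma_i$ density operators on $\mathbb{C}^{d_A}$, $\mathbb{C}^{d_B}$) that form a full orthogonal set: $\operatorname{tr}(\rho_i\rho_j)=0$ for $i\neq j$, and $\sum_i\rho_i$ has full rank $d_Ad_B$. If some measurement $\{M_i\}_{i\in[n]}$ in $\overline{\mathrm{LOCC}}$ discriminates these states perfectly, i.e. $\operatorname{tr}(M_i\rho_j)=\delta_{ij}$ for all $i,j$, then so does some measurement in $\mathrm{LOCC}_{\mathbb{N}}$. -/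

import Mathlib

open scoped Kronecker Matrix ComplexOrder

namespace LOCC

/-- Operators on the bipartite space `ℂ^dA ⊗ ℂ^dB`. -/
abbrev BipOp (dA dB : ℕ) : Type := Matrix (Fin dA × Fin dB) (Fin dA × Fin dB) ℂ

/-- A quantum instrument on `ℂ^d` with finitely many classical outcomes `j`. On outcome `j` it
applies the completely positive map `X ↦ ∑ k, K j k * X * (K j k)ᴴ` into the operators on
`ℂ^(outDim j)`, and these maps sum up to a trace preserving one. The output dimension is arbitrary,
so that ancillas, partial traces and private memory are all allowed. -/
structure Instrument (d : ℕ) where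
  outcomes : ℕ
  outDim : Fin outcomes → ℕ
  krausCount : Fin outcomes → ℕ
  K : (j : Fin outcomes) → Fin (krausCount j) → Matrix (Fin (outDim j)) (Fin d) ℂ
  trace_preserving : ∑ j, ∑ k, (K j k)ᴴ * K j k = 1

/-- Finite bipartite LOCC protocols on `ℂ^dA ⊗ ℂ^dB` that output a label in `Fin n`. A protocol
either stops and outputs a label, or one of the parties applies a local instrument and communicates
its outcome `j`, whereupon the parties go on with a protocol that may depend on `j`. -/
inductive Protocol (n : ℕ) : ℕ → ℕ → Type
  | output {dA dB : ℕ} (i : Fin n) : Protocol n dA dB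
  | alice {dA dB : ℕ} (J : Instrument dA) (next : ∀ j, Protocol n (J.outDim j) dB) :
      Protocol n dA dB
  | bob {dA dB : ℕ} (J : Instrument dB) (next : ∀ j, Protocol n dA (J.outDim j)) :
      Protocol n dA dB

/-- The measurement (POVM) that a protocol implements: on input state `ρ` the label `i` is output
with probability `tr (P.povm i * ρ)`. -/
def Protocol.povm {n : ℕ} : {dA dB : ℕ} → Protocol n dA dB → Fin n → BipOp dA dB
  | _, _, .output o => fun i => if i = o then 1 else 0
  | _, dB, .alice J next => fun i => ∑ j, ∑ k,
      (J.K j k ⊗ₖ (1 : Matrix (Fin dB) (Fin dB) ℂ))ᴴ * (next j).povm i *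
        (J.K j k ⊗ₖ (1 : Matrix (Fin dB) (Fin dB) ℂ))
  | dA, _, .bob J next => fun i => ∑ j, ∑ k,
      ((1 : Matrix (Fin dA) (Fin dA) ℂ) ⊗ₖ J.K j k)ᴴ * (next j).povm i *
        ((1 : Matrix (Fin dA) (Fin dA) ℂ) ⊗ₖ J.K j k)

/-- `M` can be implemented exactly by a finite LOCC protocol. -/
def IsFiniteLOCC {dA dB n : ℕ} (M : Fin n → BipOp dA dB) : Prop :=
  ∃ P : Protocol n dA dB, P.povm = M

/-- `M` is implemented with vanishing error by a sequence of finite LOCC protocols. -/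
def IsAsymptoticLOCC {dA dB n : ℕ} (M : Fin n → BipOp dA dB) : Prop :=
  ∃ P : ℕ → Protocol n dA dB,
    Filter.Tendsto (fun t => (P t).povm) Filter.atTop (nhds M)

/-- A projective measurement: mutually orthogonal orthogonal projectors that sum to the identity. -/
structure IsProjectiveMeasurement {dA dB n : ℕ} (M : Fin n → BipOp dA dB) : Prop where
  isProj : ∀ i, IsStarProjection (M i)
  orthogonal : ∀ i j, i ≠ j → M i * M j = 0
  sum_eq_one : ∑ i, M i = 1

/-- Density operators. -/
def IsState {ι : Type*} [Fintype ι] (ρ : Matrix ι ι ℂ) : Prop :=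
  ρ.PosSemidef ∧ ρ.trace = 1

/-- A full orthogonal set of bipartite states: mutually orthogonal states whose sum has full rank. -/
structure IsFullOrthogonalSet {dA dB n : ℕ} (ρ : Fin n → BipOp dA dB) : Prop where
  isState : ∀ i, IsState (ρ i)
  orthogonal : ∀ i j, i ≠ j → (ρ i * ρ j).trace = 0
  full_rank : (∑ i, ρ i).rank = dA * dB

/-- The measurement `M` identifies the index `i` of the state `ρ i` without error. -/
def Discriminates {dA dB n : ℕ} (M ρ : Fin n → BipOp dA dB) : Prop :=
  ∀ i j, (M i * ρ j).trace = if i = j then 1 else 0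

end LOCC

/-!
Let a protocol of small error implement `M` approximately. The loss of a node of its tree, relative
to the weight of the Kraus operators accumulated so far, averages over the children, so a path of
small relative loss leads from the root to a leaf. Along this path the effects accumulated by Alice
and Bob, normalised to trace one, form pairs whose tensor product almost commutes with all `M i`.
The path starts at multiples of the identity, and it cannot end near them, because a leaf outputs a
single label. Each step changes only one tensor factor, so the segment between consecutive pairs
still almost commutes, and some almost commuting pair lies on a fixed small sphere around the start.
By compactness, if `M` is a limit of such protocols, then some `A ⊗ B` on this sphere commutes with
all `M i` exactly.

If the `M i` are products, they then commute with a nontrivial spectral projector of `A` or of `B`.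
Measuring this projector first does no harm and leaves a problem of the same kind in smaller
dimension, which gives a finite protocol by induction.

For a full orthogonal set of states, the only measurement that discriminates them consists of the
projectors onto their ranges; for product states these are products.
-/

namespace LOCC

open scoped Matrix.Norms.Frobenius MatrixOrder

section Frobenius

@[fun_prop]
theorem continuous_kronecker {m n p q X : Type*} [TopologicalSpace X] {f : X → Matrix m n ℂ}
    {g : X → Matrix p q ℂ} (hf : Continuous f) (hg : Continuous g) :
    Continuous fun x => f x ⊗ₖ g x :=
  continuous_matrix fun i j => (hf.matrix_elem i.1 j.1).mul (hg.matrix_elem i.2 j.2)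

theorem sum_kronecker {m n p q κ : Type*} (s : Finset κ) (A : κ → Matrix m n ℂ)
    (B : Matrix p q ℂ) : (∑ x ∈ s, A x) ⊗ₖ B = ∑ x ∈ s, A x ⊗ₖ B := by
  ext
  simp [Matrix.sum_apply, Finset.sum_mul]

theorem kronecker_sum {m n p q κ : Type*} (s : Finset κ) (A : Matrix m n ℂ)
    (B : κ → Matrix p q ℂ) : A ⊗ₖ (∑ x ∈ s, B x) = ∑ x ∈ s, A ⊗ₖ B x := by
  ext
  simp [Matrix.sum_apply, Finset.mul_sum]

variable {m n p q : Type*} [Fintype m] [Fintype n] [Fintype p] [Fintype q]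

theorem trace_conjTranspose_mul_self (X : Matrix m n ℂ) : (Xᴴ * X).trace = (‖X‖ ^ 2 : ℝ) := by
  rw [Matrix.frobenius_norm_def, ← Real.sqrt_eq_rpow, Real.sq_sqrt (by positivity),
    Finset.sum_comm]
  simp [Matrix.trace, Matrix.mul_apply, Complex.conj_mul']

theorem norm_kronecker (A : Matrix m n ℂ) (B : Matrix p q ℂ) : ‖A ⊗ₖ B‖ = ‖A‖ * ‖B‖ := by
  have h : ((‖A ⊗ₖ B‖ ^ 2 : ℝ) : ℂ) = ((‖A‖ * ‖B‖) ^ 2 : ℝ) := by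
    rw [← trace_conjTranspose_mul_self, Matrix.conjTranspose_kronecker,
      ← Matrix.mul_kronecker_mul, Matrix.trace_kronecker, trace_conjTranspose_mul_self,
      trace_conjTranspose_mul_self, mul_pow, Complex.ofReal_mul]
  exact (pow_left_inj₀ (norm_nonneg _) (by positivity) two_ne_zero).mp (Complex.ofReal_injective h)

end Frobenius

section Corner

variable {m ι : Type*} [Fintype m]

theorem exists_eq_conjTranspose_mul_self {Q : Matrix m m ℂ} (hQ : Q.PosSemidef) :
    ∃ D : Matrix m m ℂ, Q = Dᴴ * D := by
  classical
  exact CStarAlgebra.nonneg_iff_eq_star_mul_self.mp (Matrix.nonneg_iff_posSemidef.mpr hQ)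

theorem posSemidef_of_isStarProjection {R : Matrix m m ℂ} (hR : IsStarProjection R) :
    R.PosSemidef :=
  Matrix.nonneg_iff_posSemidef.mp hR.nonneg

theorem re_trace_mul_nonneg {Q R : Matrix m m ℂ} (hQ : Q.PosSemidef) (hR : R.PosSemidef) :
    0 ≤ (Q * R).trace.re := by
  obtain ⟨D, rfl⟩ := exists_eq_conjTranspose_mul_self hQ
  rw [Matrix.mul_assoc, Matrix.trace_mul_comm]
  exact (Complex.le_def.mp (hR.mul_mul_conjTranspose_same D).trace_nonneg).1

theorem norm_mul_mul_le_sqrt_trace {Q R R' : Matrix m m ℂ} (hQ : Q.PosSemidef)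
    (hR : IsStarProjection R) (hR' : IsStarProjection R') :
    ‖R * Q * R'‖ ≤ √(Q * R).trace.re * √(Q * R').trace.re := by
  obtain ⟨D, rfl⟩ := exists_eq_conjTranspose_mul_self hQ
  have hD : ∀ {S : Matrix m m ℂ}, IsStarProjection S → √(Dᴴ * D * S).trace.re = ‖D * S‖ := by
    intro S hS
    have hSD : (Dᴴ * D * S).trace = ((D * S)ᴴ * (D * S)).trace := by
      rw [Matrix.conjTranspose_mul, show Sᴴ = S from hS.2, Matrix.mul_assoc S,
        Matrix.trace_mul_comm S]
      simp only [Matrix.mul_assoc, show S * S = S from hS.1]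
    rw [hSD, trace_conjTranspose_mul_self, Complex.ofReal_re, Real.sqrt_sq (norm_nonneg _)]
  calc ‖R * (Dᴴ * D) * R'‖ = ‖(D * R)ᴴ * (D * R')‖ := by
        rw [Matrix.conjTranspose_mul, show Rᴴ = R from hR.2]
        simp only [Matrix.mul_assoc]
    _ ≤ ‖(D * R)ᴴ‖ * ‖D * R'‖ := Matrix.frobenius_norm_mul _ _
    _ = _ := by rw [Matrix.frobenius_norm_conjTranspose, hD hR, hD hR']

theorem trace_mul_le_trace {Q R : Matrix m m ℂ} (hQ : Q.PosSemidef)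
    (hR : IsStarProjection R) : (Q * R).trace.re ≤ Q.trace.re := by
  classical
  have h := re_trace_mul_nonneg hQ (posSemidef_of_isStarProjection hR.one_sub)
  rw [Matrix.mul_sub, Matrix.mul_one, Matrix.trace_sub, Complex.sub_re] at h
  linarith

variable [Fintype ι] [DecidableEq ι] {R Q : ι → Matrix m m ℂ}

/-- The sum over all `i` of the unnormalised probability that the measurement with effects `Q o`
outputs a label `o ≠ i` on input `R i`. -/
noncomputable def error (R Q : ι → Matrix m m ℂ) : ℝ :=
  ∑ o, ∑ i ∈ Finset.univ.erase o, (Q o * R i).trace.re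

theorem error_nonneg (hQ : ∀ o, (Q o).PosSemidef) (hR : ∀ i, (R i).PosSemidef) :
    0 ≤ error R Q :=
  Finset.sum_nonneg fun o _ => Finset.sum_nonneg fun i _ =>
    re_trace_mul_nonneg (hQ o) (hR i)

theorem error_sum {κ : Type*} (s : Finset κ) (Q : κ → ι → Matrix m m ℂ) :
    error R (fun o => ∑ x ∈ s, Q x o) = ∑ x ∈ s, error R (Q x) := by
  simp only [error, Matrix.sum_mul, Matrix.trace_sum, Complex.re_sum]
  rw [Finset.sum_congr rfl fun o _ => Finset.sum_comm, Finset.sum_comm]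

@[fun_prop]
theorem continuous_error (R : ι → Matrix m m ℂ) : Continuous (error R) := by
  unfold error; fun_prop

/-- One of `i`, `j` differs from `o`, so each `Q o` contributes to the `(i, j)` corner at most the
geometric mean of its error and its trace. -/
theorem norm_corner_sum_sq_le (hQ : ∀ o, (Q o).PosSemidef) (hR : ∀ i, IsStarProjection (R i))
    {i j : ι} (hij : i ≠ j) :
    ‖R i * (∑ o, Q o) * R j‖ ^ 2 ≤ error R Q * (∑ o, Q o).trace.re := by
  set e : ι → ℝ := fun o => ∑ i ∈ Finset.univ.erase o, (Q o * R i).trace.re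
  have hnonneg : ∀ o i, 0 ≤ (Q o * R i).trace.re := fun o i =>
    re_trace_mul_nonneg (hQ o) (posSemidef_of_isStarProjection (hR i))
  have he : ∀ {o i}, i ≠ o → (Q o * R i).trace.re ≤ e o := fun {o i} hi =>
    Finset.single_le_sum (f := fun i => (Q o * R i).trace.re) (fun i _ => hnonneg o i)
      (Finset.mem_erase.mpr ⟨hi, Finset.mem_univ i⟩)
  have hcorner : ∀ o, ‖R i * Q o * R j‖ ≤ √(e o) * √(Q o).trace.re := by
    intro o
    refine (norm_mul_mul_le_sqrt_trace (hQ o) (hR i) (hR j)).trans ?_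
    have ht : ∀ i, √(Q o * R i).trace.re ≤ √(Q o).trace.re := fun i =>
      Real.sqrt_le_sqrt (trace_mul_le_trace (hQ o) (hR i))
    rcases eq_or_ne i o with rfl | hi
    · rw [mul_comm]
      exact mul_le_mul (Real.sqrt_le_sqrt (he hij.symm)) (ht i) (Real.sqrt_nonneg _)
        (Real.sqrt_nonneg _)
    · exact mul_le_mul (Real.sqrt_le_sqrt (he hi)) (ht j) (Real.sqrt_nonneg _) (Real.sqrt_nonneg _)
  have hsum : ‖R i * (∑ o, Q o) * R j‖ ≤ √(error R Q) * √(∑ o, Q o).trace.re := by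
    calc ‖R i * (∑ o, Q o) * R j‖ ≤ ∑ o, √(e o) * √(Q o).trace.re := by
          rw [Finset.mul_sum, Finset.sum_mul]
          exact (norm_sum_le _ _).trans (Finset.sum_le_sum fun o _ => hcorner o)
      _ ≤ √(∑ o, e o) * √(∑ o, (Q o).trace.re) := Real.sum_sqrt_mul_sqrt_le _
          (fun o => Finset.sum_nonneg fun i _ => hnonneg o i)
          (fun o => (Complex.le_def.mp (hQ o).trace_nonneg).1)
      _ = _ := by rw [Matrix.trace_sum, Complex.re_sum]; rfl
  calc _ ≤ (√(error R Q) * √(∑ o, Q o).trace.re) ^ 2 := by gcongr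
    _ = _ := by
      rw [mul_pow, Real.sq_sqrt (error_nonneg hQ fun i => posSemidef_of_isStarProjection (hR i)),
        Real.sq_sqrt (Complex.le_def.mp (Matrix.posSemidef_sum _ fun o _ => hQ o).trace_nonneg).1]

end Corner

section Loss

theorem Instrument.sum_conjTranspose_mul_self {a : Type*} {d : ℕ} (J : Instrument d)
    (A : Matrix (Fin d) a ℂ) :
    ∑ j, ∑ k, (J.K j k * A)ᴴ * (J.K j k * A) = Aᴴ * A := by
  calc _ = Aᴴ * (∑ j, ∑ k, (J.K j k)ᴴ * J.K j k) * A := by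
        simp only [Matrix.conjTranspose_mul, Matrix.mul_assoc, Matrix.mul_sum, Matrix.sum_mul]
    _ = Aᴴ * A := by rw [J.trace_preserving, Matrix.mul_one]

variable {n dA dB : ℕ} {a b : Type*} [Fintype a] [Fintype b]

theorem Instrument.sum_norm_sq {d : ℕ} (J : Instrument d) (A : Matrix (Fin d) a ℂ) :
    ∑ j, ∑ k, ‖J.K j k * A‖ ^ 2 = ‖A‖ ^ 2 := by
  have h := congrArg (fun X => X.trace.re) (J.sum_conjTranspose_mul_self A)
  simpa only [Matrix.trace_sum, Complex.re_sum, trace_conjTranspose_mul_self,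
    Complex.ofReal_re] using h

theorem Protocol.povm_posSemidef (P : Protocol n dA dB) (i : Fin n) : (P.povm i).PosSemidef := by
  induction P with
  | output o =>
    simp only [Protocol.povm]
    split_ifs
    exacts [.one, .zero]
  | alice J next ih =>
    exact Matrix.posSemidef_sum _ fun j _ => Matrix.posSemidef_sum _ fun k _ =>
      (ih j).conjTranspose_mul_mul_same _
  | bob J next ih =>
    exact Matrix.posSemidef_sum _ fun j _ => Matrix.posSemidef_sum _ fun k _ =>
      (ih j).conjTranspose_mul_mul_same _

theorem Protocol.sum_povm (P : Protocol n dA dB) : ∑ i, P.povm i = 1 := by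
  induction P with
  | output o => simp [Protocol.povm]
  | alice J next ih =>
    simp only [Protocol.povm]
    rw [Finset.sum_comm, Finset.sum_congr rfl fun j _ => Finset.sum_comm]
    simp only [← Matrix.sum_mul, ← Matrix.mul_sum, ih, Matrix.mul_one,
      Matrix.conjTranspose_kronecker, ← Matrix.mul_kronecker_mul, Matrix.conjTranspose_one,
      ← sum_kronecker, J.trace_preserving, Matrix.one_kronecker_one]
  | bob J next ih =>
    simp only [Protocol.povm]
    rw [Finset.sum_comm, Finset.sum_congr rfl fun j _ => Finset.sum_comm]
    simp only [← Matrix.sum_mul, ← Matrix.mul_sum, ih, Matrix.mul_one,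
      Matrix.conjTranspose_kronecker, ← Matrix.mul_kronecker_mul, Matrix.conjTranspose_one,
      ← kronecker_sum, J.trace_preserving, Matrix.one_kronecker_one]

/-- The error of the protocol `P` that is run after the local Kraus operators `A` and `B`, as a
measurement of the inputs `R i`. -/
noncomputable def loss (R : Fin n → Matrix (a × b) (a × b) ℂ) (P : Protocol n dA dB)
    (A : Matrix (Fin dA) a ℂ) (B : Matrix (Fin dB) b ℂ) : ℝ :=
  error R fun o => (A ⊗ₖ B)ᴴ * P.povm o * (A ⊗ₖ B)

variable {R : Fin n → Matrix (a × b) (a × b) ℂ}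

theorem loss_alice (J : Instrument dA) (next : ∀ j, Protocol n (J.outDim j) dB)
    (A : Matrix (Fin dA) a ℂ) (B : Matrix (Fin dB) b ℂ) :
    loss R (.alice J next) A B = ∑ j, ∑ k, loss R (next j) (J.K j k * A) B := by
  have hK : ∀ j k, (J.K j k * A) ⊗ₖ B =
      (J.K j k ⊗ₖ (1 : Matrix (Fin dB) (Fin dB) ℂ)) * (A ⊗ₖ B) := fun j k => by
    rw [← Matrix.mul_kronecker_mul, Matrix.one_mul]
  simp only [loss, ← error_sum, hK, Protocol.povm, Matrix.mul_sum, Matrix.sum_mul,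
    Matrix.conjTranspose_mul, Matrix.mul_assoc]

theorem loss_bob (J : Instrument dB) (next : ∀ j, Protocol n dA (J.outDim j))
    (A : Matrix (Fin dA) a ℂ) (B : Matrix (Fin dB) b ℂ) :
    loss R (.bob J next) A B = ∑ j, ∑ k, loss R (next j) A (J.K j k * B) := by
  have hK : ∀ j k, A ⊗ₖ (J.K j k * B) =
      ((1 : Matrix (Fin dA) (Fin dA) ℂ) ⊗ₖ J.K j k) * (A ⊗ₖ B) := fun j k => by
    rw [← Matrix.mul_kronecker_mul, Matrix.one_mul]
  simp only [loss, ← error_sum, hK, Protocol.povm, Matrix.mul_sum, Matrix.sum_mul,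
    Matrix.conjTranspose_mul, Matrix.mul_assoc]

theorem loss_output (o : Fin n) (A : Matrix (Fin dA) a ℂ) (B : Matrix (Fin dB) b ℂ) :
    loss R (.output o) A B =
      ∑ i ∈ Finset.univ.erase o, ((A ⊗ₖ B)ᴴ * (A ⊗ₖ B) * R i).trace.re := by
  rw [loss, error, Finset.sum_eq_single_of_mem o (Finset.mem_univ o)]
  · simp [Protocol.povm]
  · intro o' _ ho'
    simp [Protocol.povm, ho']

theorem loss_nonneg (hR : ∀ i, (R i).PosSemidef) (P : Protocol n dA dB)
    (A : Matrix (Fin dA) a ℂ) (B : Matrix (Fin dB) b ℂ) : 0 ≤ loss R P A B :=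
  error_nonneg (fun o => (P.povm_posSemidef o).conjTranspose_mul_mul_same _) hR

theorem norm_corner_sq_le_loss_mul (hR : ∀ i, IsStarProjection (R i)) {i j : Fin n} (hij : i ≠ j)
    (P : Protocol n dA dB) (A : Matrix (Fin dA) a ℂ) (B : Matrix (Fin dB) b ℂ) :
    ‖R i * ((A ⊗ₖ B)ᴴ * (A ⊗ₖ B)) * R j‖ ^ 2 ≤ loss R P A B * ‖A ⊗ₖ B‖ ^ 2 := by
  have h := norm_corner_sum_sq_le
    (fun o => (P.povm_posSemidef o).conjTranspose_mul_mul_same (A ⊗ₖ B)) hR hij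
  rwa [← Matrix.sum_mul, ← Matrix.mul_sum, P.sum_povm, Matrix.mul_one,
    trace_conjTranspose_mul_self, Complex.ofReal_re] at h

end Loss

section AlmostCommuting

variable {m a b ι : Type*} [Fintype m] [Fintype a] [Fintype b]

/-- The effect `Aᴴ * A`, rescaled to trace one (and `0` if `A = 0`). -/
noncomputable def normalized (A : Matrix m a ℂ) : Matrix a a ℂ := (‖A‖ ^ 2)⁻¹ • (Aᴴ * A)

theorem isHermitian_normalized (A : Matrix m a ℂ) : (normalized A).IsHermitian :=
  (Matrix.isHermitian_conjTranspose_mul_self A).smul (IsSelfAdjoint.all _)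

theorem trace_normalized {A : Matrix m a ℂ} (hA : A ≠ 0) : (normalized A).trace = 1 := by
  rw [normalized, Matrix.trace_smul, trace_conjTranspose_mul_self, Complex.real_smul,
    ← Complex.ofReal_mul, inv_mul_cancel₀ (pow_ne_zero 2 (norm_ne_zero_iff.mpr hA)),
    Complex.ofReal_one]

theorem normalized_kronecker {p : Type*} [Fintype p] (A : Matrix m a ℂ) (B : Matrix p b ℂ) :
    normalized (A ⊗ₖ B) = normalized A ⊗ₖ normalized B := by
  rw [normalized, normalized, normalized, Matrix.smul_kronecker, Matrix.kronecker_smul, smul_smul,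
    norm_kronecker, mul_pow, mul_inv, Matrix.conjTranspose_kronecker, ← Matrix.mul_kronecker_mul]

theorem norm_sq_smul_normalized (A : Matrix m a ℂ) : ‖A‖ ^ 2 • normalized A = Aᴴ * A := by
  rcases eq_or_ne A 0 with rfl | hA
  · simp
  · rw [normalized, smul_inv_smul₀ (pow_ne_zero 2 (norm_ne_zero_iff.mpr hA))]

/-- Pairs of Hermitian operators of trace one whose tensor product has corners of norm at most `ε`
between the projections `R i`. For a projective measurement `R`, the tensor product then commutes
with all `R i` up to an error of order `ε`. -/
structure AlmostCommutes (R : ι → Matrix (a × b) (a × b) ℂ) (ε : ℝ)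
    (p : Matrix a a ℂ × Matrix b b ℂ) : Prop where
  isHermitian_fst : p.1.IsHermitian
  isHermitian_snd : p.2.IsHermitian
  trace_fst : p.1.trace = 1
  trace_snd : p.2.trace = 1
  norm_corner_le : ∀ i j, i ≠ j → ‖R i * (p.1 ⊗ₖ p.2) * R j‖ ≤ ε

theorem convex_isHermitian_trace_one :
    Convex ℝ {X : Matrix a a ℂ | X.IsHermitian ∧ X.trace = 1} := by
  intro X hX Y hY s t _ _ hst
  refine ⟨(hX.1.smul (IsSelfAdjoint.all s)).add (hY.1.smul (IsSelfAdjoint.all t)), ?_⟩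
  rw [Matrix.trace_add, Matrix.trace_smul, Matrix.trace_smul, hX.2, hY.2, ← add_smul, hst, one_smul]

variable {R : ι → Matrix (a × b) (a × b) ℂ} {ε : ℝ}

theorem isClosed_setOf_almostCommutes : IsClosed {p | AlmostCommutes R ε p} := by
  have hset : {p | AlmostCommutes R ε p} = {p | p.1ᴴ = p.1} ∩ {p | p.2ᴴ = p.2} ∩
      {p | p.1.trace = 1} ∩ {p | p.2.trace = 1} ∩
      ⋂ (i) (j) (_ : i ≠ j), {p | ‖R i * (p.1 ⊗ₖ p.2) * R j‖ ≤ ε} := by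
    ext p
    simp only [Set.mem_inter_iff, Set.mem_iInter]
    exact ⟨fun ⟨h1, h2, h3, h4, h5⟩ => ⟨⟨⟨⟨h1, h2⟩, h3⟩, h4⟩, h5⟩,
      fun ⟨⟨⟨⟨h1, h2⟩, h3⟩, h4⟩, h5⟩ => ⟨h1, h2, h3, h4, h5⟩⟩
  rw [hset]
  refine ((((isClosed_eq ?_ ?_).inter (isClosed_eq ?_ ?_)).inter (isClosed_eq ?_ ?_)).inter
    (isClosed_eq ?_ ?_)).inter (isClosed_iInter fun i => isClosed_iInter fun j =>
      isClosed_iInter fun _ => isClosed_le ?_ ?_)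
  all_goals fun_prop

theorem AlmostCommutes.segment {p q : Matrix a a ℂ × Matrix b b ℂ} (hp : AlmostCommutes R ε p)
    (hq : AlmostCommutes R ε q) (hpq : p.1 = q.1 ∨ p.2 = q.2) {r : Matrix a a ℂ × Matrix b b ℂ}
    (hr : r ∈ segment ℝ p q) : AlmostCommutes R ε r := by
  obtain ⟨s, t, hs, ht, hst, rfl⟩ := hr
  have h1 := convex_isHermitian_trace_one ⟨hp.1, hp.3⟩ ⟨hq.1, hq.3⟩ hs ht hst
  have h2 := convex_isHermitian_trace_one ⟨hp.2, hp.4⟩ ⟨hq.2, hq.4⟩ hs ht hst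
  have hk : (s • p + t • q).1 ⊗ₖ (s • p + t • q).2 = s • (p.1 ⊗ₖ p.2) + t • (q.1 ⊗ₖ q.2) := by
    simp only [Prod.fst_add, Prod.snd_add, Prod.smul_fst, Prod.smul_snd]
    rcases hpq with h | h
    · rw [h, ← add_smul, hst, one_smul, Matrix.kronecker_add, Matrix.kronecker_smul,
        Matrix.kronecker_smul]
    · rw [h, ← add_smul, hst, one_smul, Matrix.add_kronecker, Matrix.smul_kronecker,
        Matrix.smul_kronecker]
  refine ⟨h1.1, h2.1, h1.2, h2.2, fun i j hij => ?_⟩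
  rw [hk, Matrix.mul_add, Matrix.add_mul, Matrix.mul_smul, Matrix.mul_smul, Matrix.smul_mul,
    Matrix.smul_mul]
  have hball := convex_closedBall (0 : Matrix (a × b) (a × b) ℂ) ε
  simpa using hball (by simpa using hp.5 i j hij) (by simpa using hq.5 i j hij) hs ht hst

theorem AlmostCommutes.dist_le_of_forall_dist_ne {p q c : Matrix a a ℂ × Matrix b b ℂ} {δ : ℝ}
    (hp : AlmostCommutes R ε p) (hq : AlmostCommutes R ε q) (hpq : p.1 = q.1 ∨ p.2 = q.2)
    (hne : ∀ r, AlmostCommutes R ε r → dist r c ≠ δ) (hpδ : dist p c ≤ δ) : dist q c ≤ δ := by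
  by_contra! hqδ
  obtain ⟨r, hr, hrδ⟩ := (convex_segment p q).isPreconnected.intermediate_value
    (left_mem_segment ℝ p q) (right_mem_segment ℝ p q)
    (by fun_prop : ContinuousOn (fun r => dist r c) _) ⟨hpδ, hqδ.le⟩
  exact hne r (hp.segment hq hpq hr) hrδ

/-- Exact solutions on the sphere are limits of approximate ones, by compactness. -/
theorem exists_almostCommutes_zero_of_forall_pos {c : Matrix a a ℂ × Matrix b b ℂ} {δ : ℝ}
    (h : ∀ ε > 0, ∃ p, AlmostCommutes R ε p ∧ dist p c = δ) :
    ∃ p, AlmostCommutes R 0 p ∧ dist p c = δ := by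
  let K : ℕ → Set (Matrix a a ℂ × Matrix b b ℂ) := fun k =>
    {p | AlmostCommutes R (1 / (k + 1)) p} ∩ Metric.sphere c δ
  have hclosed : ∀ k, IsClosed (K k) := fun k =>
    isClosed_setOf_almostCommutes.inter Metric.isClosed_sphere
  have hmono : ∀ k, K (k + 1) ⊆ K k := fun k p hp =>
    ⟨{ hp.1 with norm_corner_le i j hij :=
        (hp.1.norm_corner_le i j hij).trans (Nat.one_div_le_one_div k.le_succ) }, hp.2⟩
  obtain ⟨p, hp⟩ := IsCompact.nonempty_iInter_of_sequence_nonempty_isCompact_isClosed K hmono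
    (fun k => h (1 / (k + 1)) (by positivity))
    ((isCompact_sphere c δ).inter_left isClosed_setOf_almostCommutes) hclosed
  rw [Set.mem_iInter] at hp
  refine ⟨p, { (hp 0).1 with norm_corner_le i j hij := ?_ }, (hp 0).2⟩
  exact ge_of_tendsto' tendsto_one_div_add_atTop_nhds_zero_nat
    fun k => (hp k).1.norm_corner_le i j hij

end AlmostCommuting

section Escape

variable {n dA dB : ℕ} {a b : Type*} [Fintype a] [Fintype b]
  {R : Fin n → Matrix (a × b) (a × b) ℂ} {κ ε δ : ℝ} {P : Protocol n dA dB}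
  {A : Matrix (Fin dA) a ℂ} {B : Matrix (Fin dB) b ℂ}

theorem almostCommutes_normalized_of_loss_lt (hR : ∀ i, IsStarProjection (R i)) (hε : 0 ≤ ε)
    (hκε : κ ≤ ε ^ 2) (hlt : loss R P A B < κ * ‖A ⊗ₖ B‖ ^ 2) :
    AlmostCommutes R ε (normalized A, normalized B) := by
  have hw : 0 < ‖A ⊗ₖ B‖ := by
    have hpos := (loss_nonneg (fun i => posSemidef_of_isStarProjection (hR i)) P A B).trans_lt hlt
    refine (norm_nonneg _).lt_of_ne fun h0 => ?_
    simp [← h0] at hpos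
  rw [norm_kronecker] at hw
  refine ⟨isHermitian_normalized A, isHermitian_normalized B,
    trace_normalized (norm_pos_iff.mp (pos_of_mul_pos_left hw (norm_nonneg B))),
    trace_normalized (norm_pos_iff.mp (pos_of_mul_pos_right hw (norm_nonneg A))),
    fun i j hij => ?_⟩
  rw [← norm_kronecker] at hw
  have hsq : ‖R i * ((A ⊗ₖ B)ᴴ * (A ⊗ₖ B)) * R j‖ ^ 2 ≤ (ε * ‖A ⊗ₖ B‖ ^ 2) ^ 2 :=
    calc _ ≤ loss R P A B * ‖A ⊗ₖ B‖ ^ 2 := norm_corner_sq_le_loss_mul hR hij P A B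
      _ ≤ (ε ^ 2 * ‖A ⊗ₖ B‖ ^ 2) * ‖A ⊗ₖ B‖ ^ 2 := by
        gcongr
        exact hlt.le.trans (by gcongr)
      _ = _ := by ring
  rw [← normalized_kronecker, normalized, Matrix.mul_smul, Matrix.smul_mul, norm_smul, norm_inv,
    norm_pow, norm_norm, inv_mul_le_iff₀ (by positivity), mul_comm]
  exact le_of_sq_le_sq hsq (by positivity)

theorem le_loss_output (hR : ∀ i, (R i).PosSemidef) {i o : Fin n} (hio : i ≠ o)
    (hκ : κ ≤ ((normalized A ⊗ₖ normalized B) * R i).trace.re) :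
    κ * ‖A ⊗ₖ B‖ ^ 2 ≤ loss R (.output o) A B := by
  have hX := Matrix.posSemidef_conjTranspose_mul_self (A ⊗ₖ B)
  calc κ * ‖A ⊗ₖ B‖ ^ 2 ≤ ((A ⊗ₖ B)ᴴ * (A ⊗ₖ B) * R i).trace.re := by
        rw [← norm_sq_smul_normalized, normalized_kronecker, Matrix.smul_mul, Matrix.trace_smul,
          Complex.smul_re, smul_eq_mul, mul_comm]
        gcongr
    _ ≤ loss R (.output o) A B := by
        rw [loss_output]
        exact Finset.single_le_sum (f := fun i => ((A ⊗ₖ B)ᴴ * (A ⊗ₖ B) * R i).trace.re)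
          (fun i _ => re_trace_mul_nonneg hX (hR i))
          (Finset.mem_erase.mpr ⟨hio, Finset.mem_univ i⟩)

theorem exists_loss_lt_of_loss_alice_lt {J : Instrument dA}
    {next : ∀ j, Protocol n (J.outDim j) dB}
    (hlt : loss R (.alice J next) A B < κ * ‖A ⊗ₖ B‖ ^ 2) :
    ∃ j k, loss R (next j) (J.K j k * A) B < κ * ‖(J.K j k * A) ⊗ₖ B‖ ^ 2 := by
  contrapose! hlt
  rw [loss_alice, norm_kronecker, mul_pow, ← J.sum_norm_sq A]
  simp only [Finset.sum_mul, Finset.mul_sum, ← mul_pow, ← norm_kronecker]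
  exact Finset.sum_le_sum fun j _ => Finset.sum_le_sum fun k _ => hlt j k

theorem exists_loss_lt_of_loss_bob_lt {J : Instrument dB}
    {next : ∀ j, Protocol n dA (J.outDim j)}
    (hlt : loss R (.bob J next) A B < κ * ‖A ⊗ₖ B‖ ^ 2) :
    ∃ j k, loss R (next j) A (J.K j k * B) < κ * ‖A ⊗ₖ (J.K j k * B)‖ ^ 2 := by
  contrapose! hlt
  rw [loss_bob, norm_kronecker, mul_pow, ← J.sum_norm_sq B]
  simp only [Finset.mul_sum, ← mul_pow, ← norm_kronecker]
  exact Finset.sum_le_sum fun j _ => Finset.sum_le_sum fun k _ => hlt j k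

variable {c : Matrix a a ℂ × Matrix b b ℂ}

/-- A node of small relative loss has a child of small relative loss. Both are almost commuting and
differ in one tensor factor, so the child cannot jump across the sphere of radius `δ`, and the walk
down the protocol ends at a leaf near `c`, where the loss is not small. -/
theorem le_loss_of_forall_dist_ne (hR : ∀ i, IsStarProjection (R i)) (hε : 0 ≤ ε)
    (hκε : κ ≤ ε ^ 2) (hne : ∀ p, AlmostCommutes R ε p → dist p c ≠ δ)
    (hleaf : ∀ p, dist p c ≤ δ → ∀ o, ∃ i ≠ o, κ ≤ ((p.1 ⊗ₖ p.2) * R i).trace.re)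
    (P : Protocol n dA dB) (A : Matrix (Fin dA) a ℂ) (B : Matrix (Fin dB) b ℂ)
    (hnear : dist (normalized A, normalized B) c ≤ δ) :
    κ * ‖A ⊗ₖ B‖ ^ 2 ≤ loss R P A B := by
  induction P with
  | output o =>
    obtain ⟨i, hio, hi⟩ := hleaf _ hnear o
    exact le_loss_output (fun i => posSemidef_of_isStarProjection (hR i)) hio hi
  | alice J next ih =>
    by_contra! hlt
    obtain ⟨j, k, hjk⟩ := exists_loss_lt_of_loss_alice_lt hlt
    have hchild := (almostCommutes_normalized_of_loss_lt hR hε hκε hlt).dist_le_of_forall_dist_ne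
      (almostCommutes_normalized_of_loss_lt hR hε hκε hjk) (.inr rfl) hne hnear
    exact hjk.not_ge (ih j _ _ hchild)
  | bob J next ih =>
    by_contra! hlt
    obtain ⟨j, k, hjk⟩ := exists_loss_lt_of_loss_bob_lt hlt
    have hchild := (almostCommutes_normalized_of_loss_lt hR hε hκε hlt).dist_le_of_forall_dist_ne
      (almostCommutes_normalized_of_loss_lt hR hε hκε hjk) (.inl rfl) hne hnear
    exact hjk.not_ge (ih j _ _ hchild)

end Escape

section Commuting

variable {n dA dB : ℕ} {ι a b : Type*} [Fintype a] [Fintype b]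

theorem exists_pos_le_re_trace_mul [Finite ι] {R : ι → Matrix (a × b) (a × b) ℂ}
    {c : Matrix a a ℂ × Matrix b b ℂ}
    (hc : ∀ i, R i ≠ 0 → 0 < ((c.1 ⊗ₖ c.2) * R i).trace.re) :
    ∃ μ > 0, ∃ δ > 0, ∀ p : Matrix a a ℂ × Matrix b b ℂ, dist p c ≤ δ → ∀ i, R i ≠ 0 →
      μ ≤ ((p.1 ⊗ₖ p.2) * R i).trace.re := by
  have hμ : ∀ᶠ μ in nhdsWithin (0 : ℝ) (Set.Ioi 0), ∀ i, R i ≠ 0 →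
      μ < ((c.1 ⊗ₖ c.2) * R i).trace.re := by
    rw [Filter.eventually_all]
    exact fun i => Filter.eventually_imp_distrib_left.mpr fun hi =>
      nhdsWithin_le_nhds (eventually_lt_nhds (hc i hi))
  obtain ⟨μ, hμ, hμ0⟩ := (hμ.and self_mem_nhdsWithin).exists
  have hδ : ∀ᶠ p in nhds c, ∀ i, R i ≠ 0 → μ < ((p.1 ⊗ₖ p.2) * R i).trace.re := by
    refine Filter.eventually_all.mpr fun i => Filter.eventually_imp_distrib_left.mpr fun hi => ?_
    have hcont : Continuous fun p : Matrix a a ℂ × Matrix b b ℂ =>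
      ((p.1 ⊗ₖ p.2) * R i).trace.re := by fun_prop
    exact hcont.continuousAt.eventually (lt_mem_nhds (hμ i hi))
  obtain ⟨δ, hδ, hball⟩ := Metric.eventually_nhds_iff.mp hδ
  exact ⟨μ, hμ0, δ / 2, half_pos hδ, fun p hp i hi =>
    (hball (hp.trans_lt (half_lt_self hδ)) i hi).le⟩

theorem re_trace_pos_of_ne_zero {m : Type*} [Fintype m] {Q : Matrix m m ℂ} (hQ : Q.PosSemidef)
    (h0 : Q ≠ 0) : 0 < Q.trace.re :=
  (Complex.pos_iff.mp (hQ.trace_nonneg.lt_of_ne' (mt hQ.trace_eq_zero_iff.mp h0))).1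

theorem loss_one_one (R : Fin n → BipOp dA dB) (P : Protocol n dA dB) :
    loss R P 1 1 = error R P.povm := by
  simp [loss]

theorem eq_normalized_one {m : Type*} [Fintype m] [DecidableEq m] {X : Matrix m m ℂ} {s : ℂ}
    (hX : X = s • 1) (htr : X.trace = 1) : X = normalized (1 : Matrix m m ℂ) := by
  have hn : ((‖(1 : Matrix m m ℂ)‖ ^ 2 : ℝ) : ℂ) = (1 : Matrix m m ℂ).trace := by
    rw [← trace_conjTranspose_mul_self, Matrix.conjTranspose_one, Matrix.mul_one]
  have hs : s = ((‖(1 : Matrix m m ℂ)‖ ^ 2 : ℝ) : ℂ)⁻¹ := by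
    rw [hX, Matrix.trace_smul, smul_eq_mul, ← hn] at htr
    exact eq_inv_of_mul_eq_one_left htr
  rw [hX, hs, normalized, Matrix.conjTranspose_one, Matrix.mul_one, ← Complex.ofReal_inv,
    Complex.coe_smul]

theorem re_trace_normalized_one_mul_pos {m p : Type*} [Fintype m] [Fintype p] [DecidableEq m]
    [DecidableEq p] {Q : Matrix (m × p) (m × p) ℂ} (hQ : Q.PosSemidef) (h0 : Q ≠ 0) :
    0 < ((normalized (1 : Matrix m m ℂ) ⊗ₖ normalized (1 : Matrix p p ℂ)) * Q).trace.re := by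
  have hone : (1 : Matrix (m × p) (m × p) ℂ) ≠ 0 := fun h =>
    h0 (by rw [← Matrix.one_mul Q, h, Matrix.zero_mul])
  rw [← normalized_kronecker, normalized, Matrix.one_kronecker_one, Matrix.conjTranspose_one,
    Matrix.mul_one, Matrix.smul_mul, Matrix.one_mul, Matrix.trace_smul, Complex.smul_re,
    smul_eq_mul]
  exact mul_pos (inv_pos.mpr (pow_pos (norm_pos_iff.mpr hone) 2)) (re_trace_pos_of_ne_zero hQ h0)

theorem IsAsymptoticLOCC.exists_almostCommutes_zero [NeZero dA] [NeZero dB]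
    {M R : Fin n → BipOp dA dB} (hM : IsAsymptoticLOCC M) (hR : ∀ i, IsStarProjection (R i))
    (herror : error R M = 0) (htwo : ∀ o, ∃ i ≠ o, R i ≠ 0) :
    ∃ p, AlmostCommutes R 0 p ∧ ((∀ s : ℂ, p.1 ≠ s • 1) ∨ ∀ s : ℂ, p.2 ≠ s • 1) ∧
      ∀ i, R i ≠ 0 → ((p.1 ⊗ₖ p.2) * R i).trace ≠ 0 := by
  let c := (normalized (1 : Matrix (Fin dA) (Fin dA) ℂ),
    normalized (1 : Matrix (Fin dB) (Fin dB) ℂ))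
  have hone : 0 < ‖(1 : Matrix (Fin dA) (Fin dA) ℂ) ⊗ₖ (1 : Matrix (Fin dB) (Fin dB) ℂ)‖ := by
    rw [norm_kronecker]
    exact mul_pos (norm_pos_iff.mpr one_ne_zero) (norm_pos_iff.mpr one_ne_zero)
  have hc : ∀ i, R i ≠ 0 → 0 < ((c.1 ⊗ₖ c.2) * R i).trace.re := fun i hi =>
    re_trace_normalized_one_mul_pos (posSemidef_of_isStarProjection (hR i)) hi
  obtain ⟨μ, hμ, δ, hδ, hle⟩ := exists_pos_le_re_trace_mul hc
  obtain ⟨p, hp, hpδ⟩ : ∃ p, AlmostCommutes R 0 p ∧ dist p c = δ := by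
    refine exists_almostCommutes_zero_of_forall_pos fun ε hε => ?_
    by_contra! hne
    obtain ⟨P, hP⟩ := hM
    -- All protocols start at `c`, inside the sphere, so they share a positive lower error bound.
    have hbound : ∀ t, min (ε ^ 2) μ * _ ≤ error R (P t).povm := fun t => by
      rw [← loss_one_one]
      refine le_loss_of_forall_dist_ne hR hε.le (min_le_left _ _) hne (fun p hp o => ?_) (P t) 1 1
        (by simpa [c] using hδ.le)
      obtain ⟨i, hio, hi⟩ := htwo o
      exact ⟨i, hio, (min_le_right _ _).trans (hle p hp i hi)⟩
    have hlim := ge_of_tendsto' (((continuous_error R).tendsto M).comp hP) hbound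
    rw [herror] at hlim
    exact hlim.not_gt (by positivity)
  refine ⟨p, hp, ?_, fun i hi h0 => ?_⟩
  · by_contra! h
    obtain ⟨⟨s, hs⟩, t, ht⟩ := h
    have hpc : p = c :=
      Prod.ext (eq_normalized_one hs hp.trace_fst) (eq_normalized_one ht hp.trace_snd)
    exact hδ.ne' (by rw [← hpδ, hpc, dist_self])
  · exact (hle p hpδ.le i hi).not_gt (by rwa [h0])

theorem commute_of_corner_eq_zero {m : Type*} [Fintype m] [Fintype ι] [DecidableEq m]
    {R : ι → Matrix m m ℂ} (hsum : ∑ i, R i = 1) {X : Matrix m m ℂ}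
    (hX : ∀ i j, i ≠ j → R i * X * R j = 0) (j : ι) : Commute X (R j) := by
  classical
  have hleft : X * R j = R j * X * R j := by
    calc X * R j = (∑ i, R i) * X * R j := by rw [hsum, Matrix.one_mul]
      _ = ∑ i, R i * X * R j := by rw [Finset.sum_mul, Finset.sum_mul]
      _ = R j * X * R j := Finset.sum_eq_single_of_mem j (Finset.mem_univ j) fun i _ hi => hX i j hi
  have hright : R j * X = R j * X * R j := by
    calc R j * X = R j * X * ∑ i, R i := by rw [hsum, Matrix.mul_one]
      _ = ∑ i, R j * X * R i := by rw [Finset.mul_sum]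
      _ = R j * X * R j :=
        Finset.sum_eq_single_of_mem j (Finset.mem_univ j) fun i _ hi => hX j i hi.symm
  exact hleft.trans hright.symm

theorem IsProjectiveMeasurement.error_self {M : Fin n → BipOp dA dB}
    (hM : IsProjectiveMeasurement M) : error M M = 0 := by
  refine Finset.sum_eq_zero fun o _ => Finset.sum_eq_zero fun i hi => ?_
  rw [hM.orthogonal o i (Finset.ne_of_mem_erase hi).symm, Matrix.trace_zero, Complex.zero_re]

theorem IsProjectiveMeasurement.exists_ne_zero {M : Fin n → BipOp dA dB}
    (hM : IsProjectiveMeasurement M) {o : Fin n} (ho : M o ≠ 1) : ∃ i ≠ o, M i ≠ 0 := by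
  contrapose! ho
  rw [← hM.sum_eq_one, Finset.sum_eq_single_of_mem o (Finset.mem_univ o) fun i _ hi => ho i hi]

theorem IsAsymptoticLOCC.exists_commute [NeZero dA] [NeZero dB] {M : Fin n → BipOp dA dB}
    (hlim : IsAsymptoticLOCC M) (hM : IsProjectiveMeasurement M) (hne : ∀ o, M o ≠ 1) :
    ∃ (A : Matrix (Fin dA) (Fin dA) ℂ) (B : Matrix (Fin dB) (Fin dB) ℂ),
      A.IsHermitian ∧ B.IsHermitian ∧ ((∀ s : ℂ, A ≠ s • 1) ∨ ∀ s : ℂ, B ≠ s • 1) ∧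
      (∀ i, Commute (A ⊗ₖ B) (M i)) ∧ ∀ i, M i ≠ 0 → ((A ⊗ₖ B) * M i).trace ≠ 0 := by
  obtain ⟨⟨A, B⟩, hAB, hscalar, htrace⟩ := hlim.exists_almostCommutes_zero hM.isProj hM.error_self
    fun o => hM.exists_ne_zero (hne o)
  exact ⟨A, B, hAB.isHermitian_fst, hAB.isHermitian_snd, hscalar,
    commute_of_corner_eq_zero hM.sum_eq_one fun i j hij =>
      norm_le_zero_iff.mp (hAB.norm_corner_le i j hij), htrace⟩

end Commuting

section Isometry

variable {d : ℕ}

theorem exists_isStarProjection_commute {m : Type*} [Fintype m] [DecidableEq m] {A : Matrix m m ℂ}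
    (hA : A.IsHermitian) (hscalar : ∀ s : ℂ, A ≠ s • 1) :
    ∃ E : Matrix m m ℂ, IsStarProjection E ∧ E ≠ 0 ∧ E ≠ 1 ∧ ∀ X, Commute A X → Commute E X := by
  have hA' : IsSelfAdjoint A := hA
  have hcont : ∀ f : ℝ → ℝ, ContinuousOn f (spectrum ℝ A) := fun f =>
    Matrix.finite_real_spectrum.continuousOn f
  have hspectrum : ∀ s : ℝ, ∃ x ∈ spectrum ℝ A, x ≠ s := by
    intro s
    contrapose! hscalar
    refine ⟨s, ?_⟩
    rw [← cfc_id' ℝ A, cfc_congr (g := fun _ => s) fun x hx => hscalar x hx, cfc_const s A,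
      Algebra.algebraMap_eq_smul_one, Complex.coe_smul]
  obtain ⟨x, hx, -⟩ := hspectrum 0
  obtain ⟨y, hy, hyx⟩ := hspectrum x
  let f : ℝ → ℝ := Set.indicator {x} 1
  refine ⟨cfc f A, ⟨?_, cfc_predicate f A⟩, fun h => ?_, fun h => ?_, fun X hX => ?_⟩
  · rw [IsIdempotentElem, ← cfc_mul f f A (hcont f) (hcont f)]
    congr 1
    ext z
    by_cases hz : z = x <;> simp [f, hz]
  · rw [← cfc_zero ℝ A, cfc_eq_cfc_iff_eqOn hA' (hcont f) (hcont _)] at h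
    simpa [f] using h hx
  · rw [← cfc_one ℝ A, cfc_eq_cfc_iff_eqOn hA' (hcont f) (hcont _)] at h
    simpa [f, hyx] using h hy
  · exact hA'.commute_cfc hX f

theorem exists_isometry_of_isStarProjection {E : Matrix (Fin d) (Fin d) ℂ}
    (hE : IsStarProjection E) :
    ∃ (r : ℕ) (V : Matrix (Fin d) (Fin r) ℂ), Vᴴ * V = 1 ∧ V * Vᴴ = E := by
  obtain ⟨U, l, hU, hl, hE⟩ : ∃ (U : Matrix (Fin d) (Fin d) ℂ) (l : Fin d → ℝ),
      Uᴴ * U = 1 ∧ (∀ i, l i ≠ 0 → l i = 1) ∧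
        E = U * Matrix.diagonal (fun i => (l i : ℂ)) * Uᴴ := by
    have hH : E.IsHermitian := hE.2
    refine ⟨hH.eigenvectorUnitary, hH.eigenvalues, Unitary.coe_star_mul_self _, fun i =>
      (hE.1.spectrum_subset ℝ (hH.eigenvalues_mem_spectrum_real i)).resolve_left, ?_⟩
    exact hH.spectral_theorem.trans (Unitary.conjStarAlgAut_apply _ _)
  let e := (Fintype.equivFin {i // l i ≠ 0}).symm
  refine ⟨_, U.submatrix id fun k => (e k : Fin d), ?_, ?_⟩
  · rw [Matrix.conjTranspose_submatrix, ← Matrix.submatrix_mul _ _ _ _ _ Function.bijective_id, hU]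
    exact Matrix.submatrix_one _ (Subtype.val_injective.comp e.injective)
  · ext x y
    rw [hE, Matrix.mul_apply, Matrix.mul_apply]
    simp only [Matrix.submatrix_apply, Matrix.conjTranspose_apply, Matrix.mul_diagonal, id]
    rw [e.sum_comp fun i : {i // l i ≠ 0} => U x i * star (U y i),
      ← Finset.sum_subtype (Finset.univ.filter fun i => l i ≠ 0) (by simp)
        fun i => U x i * star (U y i), Finset.sum_filter]
    refine Finset.sum_congr rfl fun i _ => ?_
    split_ifs with h
    · rw [hl i h, Complex.ofReal_one, mul_one]
    · rw [not_not.mp h, Complex.ofReal_zero, mul_zero, zero_mul]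

theorem lt_of_isometry_of_ne_one {r : ℕ} {V : Matrix (Fin d) (Fin r) ℂ} (hV : Vᴴ * V = 1)
    (hne : V * Vᴴ ≠ 1) : r < d := by
  have hP : IsStarProjection (V * Vᴴ) :=
    ⟨by rw [IsIdempotentElem, Matrix.mul_assoc, ← Matrix.mul_assoc Vᴴ, hV, Matrix.one_mul],
      Matrix.isHermitian_mul_conjTranspose_self V⟩
  have hpos := re_trace_pos_of_ne_zero (posSemidef_of_isStarProjection hP.one_sub)
    (sub_ne_zero.mpr hne.symm)
  rw [Matrix.trace_sub, Matrix.trace_mul_comm, hV] at hpos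
  simpa using hpos

end Isometry

section Swap

variable {n dA dB : ℕ} {a b p q : Type*} [Fintype a] [Fintype b] [DecidableEq a] [DecidableEq b]

/-- The exchange of the two tensor factors, which is used to exchange the roles of Alice and Bob. -/
def swapFactors : Matrix (a × b) (a × b) ℂ ≃⋆ₐ[ℂ] Matrix (b × a) (b × a) ℂ :=
  StarAlgEquiv.ofAlgEquiv (Matrix.reindexAlgEquiv ℂ ℂ (Equiv.prodComm a b)) fun _ => rfl

theorem swapFactors_eq_submatrix (X : Matrix (a × b) (a × b) ℂ) :
    swapFactors X = X.submatrix (Equiv.prodComm b a) (Equiv.prodComm b a) :=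
  rfl

theorem swapFactors_kronecker (A : Matrix a a ℂ) (B : Matrix b b ℂ) :
    swapFactors (A ⊗ₖ B) = B ⊗ₖ A := by
  ext x y
  exact mul_comm _ _

theorem swapFactors_swapFactors (X : Matrix (a × b) (a × b) ℂ) :
    swapFactors (swapFactors X) = X :=
  rfl

theorem trace_swapFactors (X : Matrix (a × b) (a × b) ℂ) : (swapFactors X).trace = X.trace :=
  (Equiv.prodComm b a).sum_comp fun x => X x x

theorem swapFactors_conjTranspose_mul_mul [Fintype p] [Fintype q] [DecidableEq p] [DecidableEq q]
    (K : Matrix p a ℂ) (L : Matrix q b ℂ) (X : Matrix (p × q) (p × q) ℂ) :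
    swapFactors ((K ⊗ₖ L)ᴴ * X * (K ⊗ₖ L)) = (L ⊗ₖ K)ᴴ * swapFactors X * (L ⊗ₖ K) := by
  have hKL : L ⊗ₖ K = (K ⊗ₖ L).submatrix (Equiv.prodComm q p) (Equiv.prodComm b a) := by
    ext x y
    exact mul_comm _ _
  rw [hKL, swapFactors_eq_submatrix, swapFactors_eq_submatrix, Matrix.conjTranspose_submatrix,
    Matrix.submatrix_mul_equiv, Matrix.submatrix_mul_equiv]

/-- The protocol in which Alice and Bob have exchanged their roles. -/
def Protocol.swap : {dA dB : ℕ} → Protocol n dA dB → Protocol n dB dA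
  | _, _, .output i => .output i
  | _, _, .alice J next => .bob J fun j => (next j).swap
  | _, _, .bob J next => .alice J fun j => (next j).swap

theorem Protocol.povm_swap (P : Protocol n dA dB) (i : Fin n) :
    P.swap.povm i = swapFactors (P.povm i) := by
  induction P with
  | output o =>
    simp only [Protocol.swap, Protocol.povm]
    split_ifs <;> simp
  | alice J next ih =>
    simp only [Protocol.swap, Protocol.povm, map_sum, swapFactors_conjTranspose_mul_mul, ih]
  | bob J next ih =>
    simp only [Protocol.swap, Protocol.povm, map_sum, swapFactors_conjTranspose_mul_mul, ih]

variable {M : Fin n → BipOp dA dB}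

theorem IsFiniteLOCC.of_swap (h : IsFiniteLOCC fun i => swapFactors (M i)) :
    IsFiniteLOCC M := by
  obtain ⟨P, hP⟩ := h
  refine ⟨P.swap, funext fun i => ?_⟩
  rw [P.povm_swap, hP, swapFactors_swapFactors]

theorem IsAsymptoticLOCC.swap (h : IsAsymptoticLOCC M) :
    IsAsymptoticLOCC fun i => swapFactors (M i) := by
  obtain ⟨P, hP⟩ := h
  refine ⟨fun t => (P t).swap, tendsto_pi_nhds.mpr fun i => ?_⟩
  simp only [Protocol.povm_swap]
  have hcont : Continuous fun X : BipOp dA dB => swapFactors X :=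
    continuous_id.matrix_submatrix _ _
  exact (hcont.tendsto _).comp (tendsto_pi_nhds.mp hP i)

/-- A projective measurement all of whose effects are products of local projectors. -/
structure IsProductMeasurement (M : Fin n → BipOp dA dB) : Prop
    extends IsProjectiveMeasurement M where
  exists_eq_kronecker : ∀ i, ∃ (P : Matrix (Fin dA) (Fin dA) ℂ) (Q : Matrix (Fin dB) (Fin dB) ℂ),
    IsStarProjection P ∧ IsStarProjection Q ∧ M i = P ⊗ₖ Q

theorem IsProductMeasurement.swap (hM : IsProductMeasurement M) :
    IsProductMeasurement fun i => swapFactors (M i) where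
  isProj i := (hM.isProj i).map _
  orthogonal i j hij := by rw [← map_mul, hM.orthogonal i j hij, map_zero]
  sum_eq_one := by rw [← map_sum, hM.sum_eq_one, map_one]
  exists_eq_kronecker i := by
    obtain ⟨P, Q, hP, hQ, h⟩ := hM.exists_eq_kronecker i
    exact ⟨Q, P, hQ, hP, by rw [h, swapFactors_kronecker]⟩

end Swap

section Compression

variable {n dA dB r : ℕ} {M : Fin n → BipOp dA dB}

theorem trace_smul_eq_of_kronecker_eq {a b : Type*} [Fintype b] {X X' : Matrix a a ℂ}
    {Y Y' : Matrix b b ℂ} (h : X ⊗ₖ Y = X' ⊗ₖ Y') : Y.trace • X = Y'.trace • X' := by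
  ext i j
  simp only [Matrix.smul_apply, smul_eq_mul, Matrix.trace, Matrix.diag, Finset.sum_mul]
  refine Finset.sum_congr rfl fun k _ => ?_
  simpa only [Matrix.kroneckerMap_apply, mul_comm] using congrFun (congrFun h (i, k)) (j, k)

theorem commute_of_commute_kronecker {a b : Type*} [Fintype a] [Fintype b] {A P : Matrix a a ℂ}
    {B Q : Matrix b b ℂ} (h : Commute (A ⊗ₖ B) (P ⊗ₖ Q)) (htrace : (B * Q).trace ≠ 0) :
    Commute A P := by
  have h' : (A * P) ⊗ₖ (B * Q) = (P * A) ⊗ₖ (Q * B) := by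
    rw [Matrix.mul_kronecker_mul, Matrix.mul_kronecker_mul]
    exact h
  have := trace_smul_eq_of_kronecker_eq h'
  rw [Matrix.trace_mul_comm Q] at this
  exact smul_right_injective _ htrace this

/-- The measurement `M` on inputs in the range of Alice's isometry `V`. -/
def compress (V : Matrix (Fin dA) (Fin r) ℂ) (M : Fin n → BipOp dA dB) (i : Fin n) : BipOp r dB :=
  (V ⊗ₖ (1 : Matrix (Fin dB) (Fin dB) ℂ))ᴴ * M i * (V ⊗ₖ (1 : Matrix (Fin dB) (Fin dB) ℂ))

theorem kronecker_one_mul_conjTranspose (V : Matrix (Fin dA) (Fin r) ℂ) :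
    (V ⊗ₖ (1 : Matrix (Fin dB) (Fin dB) ℂ)) * (V ⊗ₖ (1 : Matrix (Fin dB) (Fin dB) ℂ))ᴴ =
      (V * Vᴴ) ⊗ₖ (1 : Matrix (Fin dB) (Fin dB) ℂ) := by
  rw [Matrix.conjTranspose_kronecker, ← Matrix.mul_kronecker_mul, Matrix.conjTranspose_one,
    Matrix.one_mul]

/-- The instrument that applies an isometry. -/
def Instrument.ofIsometry {V : Matrix (Fin dA) (Fin r) ℂ} (hV : Vᴴ * V = 1) : Instrument r where
  outcomes := 1
  outDim _ := dA
  krausCount _ := 1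
  K _ _ := V
  trace_preserving := by simpa using hV

theorem IsAsymptoticLOCC.compress {V : Matrix (Fin dA) (Fin r) ℂ} (hM : IsAsymptoticLOCC M)
    (hV : Vᴴ * V = 1) : IsAsymptoticLOCC (compress V M) := by
  obtain ⟨P, hP⟩ := hM
  refine ⟨fun t => .alice (.ofIsometry hV) fun _ => P t, ?_⟩
  have hpovm : ∀ t, (Protocol.alice (.ofIsometry hV) fun _ => P t).povm =
      LOCC.compress V (P t).povm := fun t => funext fun i =>
    (Fin.sum_univ_one _).trans (Fin.sum_univ_one _)
  have hcont : Continuous (LOCC.compress V : (Fin n → BipOp dA dB) → Fin n → BipOp r dB) := by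
    unfold LOCC.compress; fun_prop
  simp only [hpovm]
  exact (hcont.tendsto _).comp hP

theorem isStarProjection_conjTranspose_mul_mul {m p : Type*} [Fintype m] [Fintype p]
    {P : Matrix m m ℂ} {V : Matrix m p ℂ} [DecidableEq p] (hP : IsStarProjection P)
    (hV : Vᴴ * V = 1) (hcomm : Commute (V * Vᴴ) P) : IsStarProjection (Vᴴ * P * V) := by
  refine ⟨?_, Matrix.isHermitian_conjTranspose_mul_mul V hP.2⟩
  calc Vᴴ * P * V * (Vᴴ * P * V) = Vᴴ * P * (V * Vᴴ * P) * V := by simp only [Matrix.mul_assoc]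
    _ = Vᴴ * (P * P) * (V * (Vᴴ * V)) := by rw [hcomm.eq]; simp only [Matrix.mul_assoc]
    _ = Vᴴ * P * V := by rw [hP.1, hV, Matrix.mul_one]

theorem IsProductMeasurement.compress {V : Matrix (Fin dA) (Fin r) ℂ} (hM : IsProductMeasurement M)
    (hV : Vᴴ * V = 1)
    (hcomm : ∀ i, Commute ((V * Vᴴ) ⊗ₖ (1 : Matrix (Fin dB) (Fin dB) ℂ)) (M i)) :
    IsProductMeasurement (compress V M) := by
  set W := V ⊗ₖ (1 : Matrix (Fin dB) (Fin dB) ℂ)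
  have hW : Wᴴ * W = 1 := by
    rw [Matrix.conjTranspose_kronecker, ← Matrix.mul_kronecker_mul, hV, Matrix.conjTranspose_one,
      Matrix.one_mul, Matrix.one_kronecker_one]
  have hcommW : ∀ i, Commute (W * Wᴴ) (M i) := fun i => by
    rw [kronecker_one_mul_conjTranspose]
    exact hcomm i
  refine ⟨⟨fun i => ?_, fun i j hij => ?_, ?_⟩, fun i => ?_⟩
  · exact isStarProjection_conjTranspose_mul_mul (hM.isProj i) hW (hcommW i)
  · calc Wᴴ * M i * W * (Wᴴ * M j * W) = Wᴴ * M i * (W * Wᴴ * M j) * W := by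
          simp only [Matrix.mul_assoc]
      _ = Wᴴ * (M i * M j) * (W * Wᴴ * W) := by rw [(hcommW j).eq]; simp only [Matrix.mul_assoc]
      _ = 0 := by rw [hM.orthogonal i j hij, Matrix.mul_zero, Matrix.zero_mul]
  · calc ∑ i, Wᴴ * M i * W = Wᴴ * (∑ i, M i) * W := by rw [Matrix.mul_sum, Matrix.sum_mul]
      _ = 1 := by rw [hM.sum_eq_one, Matrix.mul_one, hW]
  · obtain ⟨P, Q, hP, hQ, hPQ⟩ := hM.exists_eq_kronecker i
    rcases eq_or_ne Q 0 with rfl | hQ0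
    · exact ⟨0, 0, .zero _, .zero _, by simp [LOCC.compress, hPQ]⟩
    have hcommP : Commute (V * Vᴴ) P := by
      have h := hcomm i
      rw [hPQ] at h
      refine commute_of_commute_kronecker h fun h0 => hQ0 ?_
      rwa [Matrix.one_mul, (posSemidef_of_isStarProjection hQ).trace_eq_zero_iff] at h0
    refine ⟨Vᴴ * P * V, Q, isStarProjection_conjTranspose_mul_mul hP hV hcommP, hQ, ?_⟩
    rw [LOCC.compress, hPQ, Matrix.conjTranspose_kronecker, ← Matrix.mul_kronecker_mul,
      ← Matrix.mul_kronecker_mul, Matrix.conjTranspose_one, Matrix.one_mul, Matrix.mul_one]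

/-- The projective measurement onto the ranges of the isometries `V j`. -/
def Instrument.ofSplitting {d m : ℕ} {r : Fin m → ℕ} {V : ∀ j, Matrix (Fin d) (Fin (r j)) ℂ}
    (hV : ∑ j, V j * (V j)ᴴ = 1) : Instrument d where
  outcomes := m
  outDim := r
  krausCount _ := 1
  K j _ := (V j)ᴴ
  trace_preserving := by simpa using hV

theorem IsFiniteLOCC.of_compress {m : ℕ} {r : Fin m → ℕ}
    {V : ∀ j, Matrix (Fin dA) (Fin (r j)) ℂ} (hV : ∑ j, V j * (V j)ᴴ = 1)
    (hVV : ∀ j, (V j)ᴴ * V j = 1)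
    (hcomm : ∀ j i, Commute ((V j * (V j)ᴴ) ⊗ₖ (1 : Matrix (Fin dB) (Fin dB) ℂ)) (M i))
    (h : ∀ j, IsFiniteLOCC (compress (V j) M)) : IsFiniteLOCC M := by
  choose P hP using h
  refine ⟨.alice (.ofSplitting hV) P, funext fun i => ?_⟩
  let W := fun j => V j ⊗ₖ (1 : Matrix (Fin dB) (Fin dB) ℂ)
  let F := fun j => (V j * (V j)ᴴ) ⊗ₖ (1 : Matrix (Fin dB) (Fin dB) ℂ)
  have hF : ∀ j, F j * F j = F j := fun j => by
    rw [← Matrix.mul_kronecker_mul, Matrix.mul_assoc, ← Matrix.mul_assoc (V j)ᴴ, hVV,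
      Matrix.one_mul, Matrix.one_mul]
  have hsum : ∑ j, F j = 1 := by
    rw [← sum_kronecker, hV, Matrix.one_kronecker_one]
  have hpovm : (Protocol.alice (.ofSplitting hV) P).povm i =
      ∑ j, ((V j)ᴴ ⊗ₖ (1 : Matrix (Fin dB) (Fin dB) ℂ))ᴴ * (P j).povm i *
        ((V j)ᴴ ⊗ₖ (1 : Matrix (Fin dB) (Fin dB) ℂ)) :=
    Finset.sum_congr rfl fun _ _ => Fin.sum_univ_one _
  have hWH : ∀ j, (V j)ᴴ ⊗ₖ (1 : Matrix (Fin dB) (Fin dB) ℂ) = (W j)ᴴ := fun j => by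
    rw [Matrix.conjTranspose_kronecker, Matrix.conjTranspose_one]
  calc (Protocol.alice (.ofSplitting hV) P).povm i
      = ∑ j, W j * ((W j)ᴴ * M i * W j) * (W j)ᴴ := by
        simp only [hpovm, hWH, hP, Matrix.conjTranspose_conjTranspose]
        rfl
    _ = ∑ j, F j * M i * F j := by
        simp only [F, ← kronecker_one_mul_conjTranspose, W, Matrix.mul_assoc]
    _ = ∑ j, M i * F j := by
        refine Finset.sum_congr rfl fun j _ => ?_
        rw [(hcomm j i).eq, Matrix.mul_assoc, hF]
    _ = M i := by rw [← Matrix.mul_sum, hsum, Matrix.mul_one]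

end Compression

section Descent

variable {n dA dB : ℕ} {M : Fin n → BipOp dA dB}

theorem IsProductMeasurement.isFiniteLOCC_of_commute (hM : IsProductMeasurement M)
    (hlim : IsAsymptoticLOCC M) {E : Matrix (Fin dA) (Fin dA) ℂ} (hE : IsStarProjection E)
    (hE0 : E ≠ 0) (hE1 : E ≠ 1)
    (hcomm : ∀ i, Commute (E ⊗ₖ (1 : Matrix (Fin dB) (Fin dB) ℂ)) (M i))
    (ih : ∀ r < dA, ∀ M' : Fin n → BipOp r dB, IsProductMeasurement M' → IsAsymptoticLOCC M' →
      IsFiniteLOCC M') : IsFiniteLOCC M := by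
  let F : Fin 2 → Matrix (Fin dA) (Fin dA) ℂ := ![E, 1 - E]
  have hF : ∀ j, IsStarProjection (F j) := Fin.forall_fin_two.mpr ⟨hE, hE.one_sub⟩
  have hF1 : ∀ j, F j ≠ 1 := Fin.forall_fin_two.mpr ⟨hE1, by simpa [F] using hE0⟩
  have hFcomm : ∀ j i, Commute (F j ⊗ₖ (1 : Matrix (Fin dB) (Fin dB) ℂ)) (M i) := by
    refine Fin.forall_fin_two.mpr ⟨hcomm, fun i => ?_⟩
    have hsub : (1 - E) ⊗ₖ (1 : Matrix (Fin dB) (Fin dB) ℂ) = 1 - E ⊗ₖ 1 := by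
      rw [eq_sub_iff_add_eq, ← Matrix.add_kronecker, sub_add_cancel, Matrix.one_kronecker_one]
    exact hsub ▸ (Commute.one_left _).sub_left (hcomm i)
  choose r V hV hVF using fun j => exists_isometry_of_isStarProjection (hF j)
  simp only [← hVF] at hF1 hFcomm
  refine .of_compress (by simp [hVF, F]) hV hFcomm fun j => ?_
  exact ih (r j) (lt_of_isometry_of_ne_one (hV j) (hF1 j)) _ (hM.compress (hV j) (hFcomm j))
    (hlim.compress (hV j))

theorem IsProductMeasurement.commute_kronecker_one (hM : IsProductMeasurement M)
    {A E : Matrix (Fin dA) (Fin dA) ℂ} {B : Matrix (Fin dB) (Fin dB) ℂ}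
    (hE : ∀ X, Commute A X → Commute E X) (hcomm : ∀ i, Commute (A ⊗ₖ B) (M i))
    (htrace : ∀ i, M i ≠ 0 → ((A ⊗ₖ B) * M i).trace ≠ 0) (i : Fin n) :
    Commute (E ⊗ₖ (1 : Matrix (Fin dB) (Fin dB) ℂ)) (M i) := by
  rcases eq_or_ne (M i) 0 with h0 | h0
  · rw [h0]
    exact Commute.zero_right _
  obtain ⟨P, Q, -, -, hPQ⟩ := hM.exists_eq_kronecker i
  have hc := hcomm i
  have ht := htrace i h0
  rw [hPQ] at hc ht ⊢
  rw [← Matrix.mul_kronecker_mul, Matrix.trace_kronecker] at ht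
  have hEP := hE P (commute_of_commute_kronecker hc (right_ne_zero_of_mul ht))
  rw [Commute, SemiconjBy, ← Matrix.mul_kronecker_mul, ← Matrix.mul_kronecker_mul, hEP.eq,
    Matrix.one_mul, Matrix.mul_one]

theorem IsProductMeasurement.isFiniteLOCC_of_commute_kronecker (hM : IsProductMeasurement M)
    (hlim : IsAsymptoticLOCC M) {A : Matrix (Fin dA) (Fin dA) ℂ} {B : Matrix (Fin dB) (Fin dB) ℂ}
    (hA : A.IsHermitian) (hscalar : ∀ s : ℂ, A ≠ s • 1) (hcomm : ∀ i, Commute (A ⊗ₖ B) (M i))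
    (htrace : ∀ i, M i ≠ 0 → ((A ⊗ₖ B) * M i).trace ≠ 0)
    (ih : ∀ r < dA, ∀ M' : Fin n → BipOp r dB, IsProductMeasurement M' → IsAsymptoticLOCC M' →
      IsFiniteLOCC M') : IsFiniteLOCC M := by
  obtain ⟨E, hE, hE0, hE1, hAE⟩ := exists_isStarProjection_commute hA hscalar
  exact hM.isFiniteLOCC_of_commute hlim hE hE0 hE1 (hM.commute_kronecker_one hAE hcomm htrace) ih

theorem IsProductMeasurement.isFiniteLOCC (hM : IsProductMeasurement M)
    (hlim : IsAsymptoticLOCC M) : IsFiniteLOCC M := by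
  induction hd : dA + dB using Nat.strong_induction_on generalizing dA dB with | _ d ih
  rcases isEmpty_or_nonempty (Fin dA × Fin dB) with hempty | ⟨⟨a, b⟩⟩
  · obtain ⟨P, -⟩ := hlim
    exact ⟨P 0, Subsingleton.elim _ _⟩
  have : NeZero dA := .of_pos a.pos
  have : NeZero dB := .of_pos b.pos
  by_cases hone : ∃ o, M o = 1
  · obtain ⟨o, ho⟩ := hone
    refine ⟨.output o, funext fun i => ?_⟩
    rcases eq_or_ne i o with rfl | hio
    · rw [ho]
      exact if_pos rfl
    · refine (if_neg hio).trans ?_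
      rw [← hM.orthogonal i o hio, ho, Matrix.mul_one]
  push Not at hone
  obtain ⟨A, B, hA, hB, hAB | hAB, hcomm, htrace⟩ :=
    hlim.exists_commute hM.toIsProjectiveMeasurement hone
  · exact hM.isFiniteLOCC_of_commute_kronecker hlim hA hAB hcomm htrace fun r hr M' hM' hlim' =>
      ih (r + dB) (by lia) hM' hlim' rfl
  · refine .of_swap (hM.swap.isFiniteLOCC_of_commute_kronecker (B := A) hlim.swap hB hAB
      (fun i => ?_) (fun i hi => ?_) fun r hr M' hM' hlim' => ih (r + dA) (by lia) hM' hlim' rfl)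
    · rw [← swapFactors_kronecker]
      exact (hcomm i).map swapFactors
    · rw [← swapFactors_kronecker, ← map_mul, trace_swapFactors]
      exact htrace i fun h => hi (by rw [h, map_zero])

end Descent

section Discrimination

theorem IsAsymptoticLOCC.posSemidef {n dA dB : ℕ} {M : Fin n → BipOp dA dB}
    (hM : IsAsymptoticLOCC M) (i : Fin n) : (M i).PosSemidef := by
  obtain ⟨P, hP⟩ := hM
  have hi := tendsto_pi_nhds.mp hP i
  refine .of_dotProduct_mulVec_nonneg ?_ fun x => ?_
  · have hconj := (continuous_id.matrix_conjTranspose.tendsto (M i)).comp hi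
    simp only [Function.comp_def, id, ((P _).povm_posSemidef i).isHermitian.eq] at hconj
    exact tendsto_nhds_unique hconj hi
  · have hc : Continuous fun X : BipOp dA dB => star x ⬝ᵥ (X *ᵥ x) := by fun_prop
    have := Complex.orderClosedTopology
    exact ge_of_tendsto' ((hc.tendsto _).comp hi)
      fun t => ((P t).povm_posSemidef i).dotProduct_mulVec_nonneg x

theorem IsAsymptoticLOCC.sum_eq_one {n dA dB : ℕ} {M : Fin n → BipOp dA dB}
    (hM : IsAsymptoticLOCC M) : ∑ i, M i = 1 := by
  obtain ⟨P, hP⟩ := hM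
  refine tendsto_nhds_unique (tendsto_finsetSum _ fun i _ => tendsto_pi_nhds.mp hP i) ?_
  simp only [Protocol.sum_povm, tendsto_const_nhds]

variable {m p ι : Type*} [Fintype m]

theorem mul_eq_zero_of_trace_mul_eq_zero {X Y : Matrix m m ℂ} (hX : X.PosSemidef)
    (hY : Y.PosSemidef) (h : (X * Y).trace = 0) : X * Y = 0 := by
  obtain ⟨C, rfl⟩ := exists_eq_conjTranspose_mul_self hX
  obtain ⟨D, rfl⟩ := exists_eq_conjTranspose_mul_self hY
  have h0 : C * Dᴴ = 0 := by
    rw [← Matrix.trace_conjTranspose_mul_self_eq_zero_iff, ← h, Matrix.conjTranspose_mul,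
      Matrix.conjTranspose_conjTranspose, Matrix.mul_assoc, Matrix.trace_mul_comm]
    simp only [Matrix.mul_assoc]
  calc Cᴴ * C * (Dᴴ * D) = Cᴴ * (C * Dᴴ) * D := by simp only [Matrix.mul_assoc]
    _ = 0 := by rw [h0, Matrix.mul_zero, Matrix.zero_mul]

theorem eq_one_of_mul_eq_of_rank [DecidableEq m] {S T : Matrix m m ℂ}
    (hT : T.rank = Fintype.card m) (h : S * T = T) : S = 1 := by
  have htop : LinearMap.range T.mulVecLin = ⊤ :=
    Submodule.eq_top_of_finrank_eq (by rw [Module.finrank_fintype_fun_eq_card]; exact hT)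
  refine Matrix.ext_of_mulVec_single fun i => ?_
  obtain ⟨y, hy⟩ := LinearMap.range_eq_top.mp htop (Pi.single i 1)
  rw [← hy, Matrix.mulVecLin_apply, Matrix.mulVec_mulVec, h, Matrix.one_mulVec]

/-- `P` is the orthogonal projector onto the range of `τ`. -/
structure IsRangeProjection (P τ : Matrix m m ℂ) : Prop where
  isProj : IsStarProjection P
  mul_eq : P * τ = τ
  exists_mul_eq : ∃ X : Matrix m m ℂ, τ * X = P

theorem exists_isRangeProjection {τ : Matrix m m ℂ} (hτ : τ.IsHermitian) :
    ∃ P, IsRangeProjection P τ := by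
  classical
  have hτ' : IsSelfAdjoint τ := hτ
  have hcont : ∀ f : ℝ → ℝ, ContinuousOn f (spectrum ℝ τ) := fun f =>
    Matrix.finite_real_spectrum.continuousOn f
  let f : ℝ → ℝ := fun x => x * x⁻¹
  let g : ℝ → ℝ := fun x => x⁻¹
  refine ⟨cfc f τ, ⟨?_, cfc_predicate f τ⟩, ?_, cfc g τ, ?_⟩
  · rw [IsIdempotentElem, ← cfc_mul f f τ (hcont f) (hcont f)]
    congr 1
    ext x
    by_cases hx : x = 0 <;> simp [f, hx]
  · calc cfc f τ * τ = cfc f τ * cfc id τ := by rw [cfc_id ℝ τ]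
      _ = cfc (fun x => f x * id x) τ := (cfc_mul f id τ (hcont f) (hcont id)).symm
      _ = τ := by simp only [f, id, mul_inv_mul_cancel, cfc_id' ℝ τ]
  · calc τ * cfc g τ = cfc id τ * cfc g τ := by rw [cfc_id ℝ τ]
      _ = cfc f τ := (cfc_mul id g τ (hcont id) (hcont _)).symm

theorem isStarProjection_kronecker [Fintype p] {P : Matrix m m ℂ} {Q : Matrix p p ℂ}
    (hP : IsStarProjection P) (hQ : IsStarProjection Q) : IsStarProjection (P ⊗ₖ Q) := by
  refine ⟨?_, ?_⟩
  · rw [IsIdempotentElem, ← Matrix.mul_kronecker_mul, hP.1.eq, hQ.1.eq]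
  · exact (Matrix.conjTranspose_kronecker P Q).trans (congrArg₂ _ hP.2 hQ.2)

namespace IsRangeProjection

theorem kronecker [Fintype p] {P τ : Matrix m m ℂ} {Q σ : Matrix p p ℂ}
    (hP : IsRangeProjection P τ) (hQ : IsRangeProjection Q σ) :
    IsRangeProjection (P ⊗ₖ Q) (τ ⊗ₖ σ) := by
  obtain ⟨X, hX⟩ := hP.exists_mul_eq
  obtain ⟨Y, hY⟩ := hQ.exists_mul_eq
  refine ⟨isStarProjection_kronecker hP.isProj hQ.isProj, ?_, X ⊗ₖ Y, ?_⟩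
  · rw [← Matrix.mul_kronecker_mul, hP.mul_eq, hQ.mul_eq]
  · rw [← Matrix.mul_kronecker_mul, hX, hY]

theorem mul_eq_zero {P τ X : Matrix m m ℂ} (hP : IsRangeProjection P τ) (h : X * τ = 0) :
    X * P = 0 := by
  obtain ⟨Y, rfl⟩ := hP.exists_mul_eq
  rw [← Matrix.mul_assoc, h, Matrix.zero_mul]

theorem mul_eq_zero_of_trace_eq_zero {P τ σ : Matrix m m ℂ} (hP : IsRangeProjection P τ)
    (hσ : σ.PosSemidef) (hτ : τ.PosSemidef) (h : (σ * τ).trace = 0) : P * σ = 0 := by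
  have hσP := hP.mul_eq_zero (mul_eq_zero_of_trace_mul_eq_zero hσ hτ h)
  rw [← Matrix.conjTranspose_eq_zero, Matrix.conjTranspose_mul, hσ.1] at hσP
  rwa [show Pᴴ = P from hP.isProj.2] at hσP

variable [DecidableEq m] [Fintype ι] {ρ E : ι → Matrix m m ℂ}

theorem sum_eq_one (hE : ∀ i, IsRangeProjection (E i) (ρ i)) (hρ : ∀ i, (ρ i).PosSemidef)
    (horth : ∀ i j, i ≠ j → (ρ i * ρ j).trace = 0) (hrank : (∑ i, ρ i).rank = Fintype.card m) :
    ∑ i, E i = 1 := by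
  refine eq_one_of_mul_eq_of_rank hrank ?_
  rw [Matrix.mul_sum]
  refine Finset.sum_congr rfl fun i _ => ?_
  rw [Matrix.sum_mul, Finset.sum_eq_single_of_mem i (Finset.mem_univ i), (hE i).mul_eq]
  exact fun j _ hj => (hE j).mul_eq_zero_of_trace_eq_zero (hρ i) (hρ j) (horth i j hj.symm)

theorem eq_of_trace_mul_eq_zero {M : ι → Matrix m m ℂ} (hE : ∀ i, IsRangeProjection (E i) (ρ i))
    (hρ : ∀ i, (ρ i).PosSemidef) (hE1 : ∑ i, E i = 1) (hM : ∀ i, (M i).PosSemidef)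
    (hM1 : ∑ i, M i = 1) (hMρ : ∀ i j, i ≠ j → (M i * ρ j).trace = 0) (i : ι) : M i = E i := by
  have hME : ∀ i j, i ≠ j → M i * E j = 0 := fun i j hij =>
    (hE j).mul_eq_zero (mul_eq_zero_of_trace_mul_eq_zero (hM i) (hρ j) (hMρ i j hij))
  calc M i = M i * ∑ j, E j := by rw [hE1, Matrix.mul_one]
    _ = M i * E i := by
      rw [Matrix.mul_sum]
      exact Finset.sum_eq_single_of_mem i (Finset.mem_univ i) fun j _ hj => hME i j hj.symm
    _ = (∑ j, M j) * E i := by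
      rw [Matrix.sum_mul]
      exact (Finset.sum_eq_single_of_mem i (Finset.mem_univ i) fun j _ hj => hME j i hj).symm
    _ = E i := by rw [hM1, Matrix.one_mul]

end IsRangeProjection

theorem IsFullOrthogonalSet.isProductMeasurement_of_discriminates {n dA dB : ℕ}
    {τ : Fin n → Matrix (Fin dA) (Fin dA) ℂ} {σ : Fin n → Matrix (Fin dB) (Fin dB) ℂ}
    (hρ : IsFullOrthogonalSet fun i => τ i ⊗ₖ σ i) (hτ : ∀ i, (τ i).IsHermitian)
    (hσ : ∀ i, (σ i).IsHermitian) {M : Fin n → BipOp dA dB} (hM : ∀ i, (M i).PosSemidef)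
    (hM1 : ∑ i, M i = 1) (hd : Discriminates M fun i => τ i ⊗ₖ σ i) : IsProductMeasurement M := by
  choose P hP using fun i => exists_isRangeProjection (hτ i)
  choose Q hQ using fun i => exists_isRangeProjection (hσ i)
  have hE := fun i => (hP i).kronecker (hQ i)
  have hpos := fun i => (hρ.isState i).1
  have hE1 := IsRangeProjection.sum_eq_one hE hpos hρ.orthogonal (by simpa using hρ.full_rank)
  obtain rfl : M = fun i => P i ⊗ₖ Q i := funext <|
    IsRangeProjection.eq_of_trace_mul_eq_zero hE hpos hE1 hM hM1 fun i j hij => by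
      rw [hd i j, if_neg hij]
  exact ⟨⟨fun i => (hE i).isProj, fun i j hij => (hE j).mul_eq_zero
    ((hE i).mul_eq_zero_of_trace_eq_zero (hpos j) (hpos i) (hρ.orthogonal j i hij.symm)), hE1⟩,
    fun i => ⟨P i, Q i, (hP i).isProj, (hQ i).isProj, rfl⟩⟩

end Discrimination

end LOCC

theorem mainTheorem1 (dA dB n : ℕ) :
    (∀ (PA : Fin n → Matrix (Fin dA) (Fin dA) ℂ) (PB : Fin n → Matrix (Fin dB) (Fin dB) ℂ),
      (∀ i, IsStarProjection (PA i)) → (∀ i, IsStarProjection (PB i)) →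
      LOCC.IsProjectiveMeasurement (fun i => PA i ⊗ₖ PB i) →
      LOCC.IsAsymptoticLOCC (fun i => PA i ⊗ₖ PB i) →
      LOCC.IsFiniteLOCC (fun i => PA i ⊗ₖ PB i)) ∧
    (∀ (τ : Fin n → Matrix (Fin dA) (Fin dA) ℂ) (σ : Fin n → Matrix (Fin dB) (Fin dB) ℂ),
      (∀ i, LOCC.IsState (τ i)) → (∀ i, LOCC.IsState (σ i)) →
      LOCC.IsFullOrthogonalSet (fun i => τ i ⊗ₖ σ i) →
      (∃ M, LOCC.IsAsymptoticLOCC M ∧ LOCC.Discriminates M (fun i => τ i ⊗ₖ σ i)) →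
      ∃ M, LOCC.IsFiniteLOCC M ∧ LOCC.Discriminates M (fun i => τ i ⊗ₖ σ i)) := by
  refine ⟨fun _ _ hPA hPB hproj hlim => LOCC.IsProductMeasurement.isFiniteLOCC
    ⟨hproj, fun i => ⟨_, _, hPA i, hPB i, rfl⟩⟩ hlim, ?_⟩
  rintro τ σ hτ hσ hρ ⟨M, hlim, hd⟩
  have hM := hρ.isProductMeasurement_of_discriminates (fun i => (hτ i).1.1) (fun i => (hσ i).1.1)
    hlim.posSemidef hlim.sum_eq_one hd
  exact ⟨M, hM.isFiniteLOCC hlim, hd⟩
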